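/- For $k\ge 1$ let $\mathfrak{it}_k$ be the number of irreducible tournaments on the vertex set $\{1,\dots,k\}$. Here a tournament is a directed graph without loops in which any two distinct vertices are joined by exactly one directed edge; it is reducible if its vertices can be partitioned into two nonempty parts $A$ and $B$ such that for all $a\in A$, $b\in B$ the edge between $a$ and $b$ goes from $a$ to $b$, and irreducible otherwise. Let $p_n$ be the probability that a uniformly random simple graph on the vertex set $\{1,\dots,n\}$ is connected. Then, as $n\to\infty$, $$p_n \approx 1-\sum_{k\ge 1}\mathfrak{it}_k\binom{n}{k}\frac{2^{k(k+1)/2}}{2^{kn}},$$ where $\approx$ has the following meaning. Put $f_0(n)=1$ and $f_k(n)=-\mathfrak{it}_k\binom{n}{k}2^{k(k+1)/2}/2^{kn}$ for $k\ge1$. Then infinitely many of the $f_k$ are not identically zero, and if $g_0,g_1,g_2,\dots$ are these $f_k$ listed in increasing order of $k$, then $$p_n=\sum_{j=0}^{r}g_j(n)+O\big(g_{r+1}(n)\big)\quad\text{and}\quad g_{r+1}(n)=o\big(g_r(n)\big)\qquad\text{for every } r\ge0 .$$ In particular, for every $r\ge 0$ (the implied constant may depend on $r$), $$p_n = 1-\sum_{k=1}^{r}\mathfrak{it}_k\binom{n}{k}\frac{2^{k(k+1)/2}}{2^{kn}}+O\!\left(\frac{n^{r+1}}{2^{(r+1)n}}\right).$$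 Moreover $\mathfrak{it}_1=1$, $\mathfrak{it}_2=0$, $\mathfrak{it}_3=2$ and $\mathfrak{it}_4=24$, so that the case $r=4$ is Wright's expansion $$p_n = 1-\binom n1 2^{1-n}-2\binom n3 2^{6-3n}-24\binom n4 2^{10-4n}+O\!\left(\frac{n^5}{2^{5n}}\right).$$ -/

import Mathlib

open Filter Asymptotics

/-- The asymptotic expansion `a n ≈ ∑_{k ≥ m} f k n` as `n → ∞`: every partial sum approximates `a`
up to a big O of the next term, and every term is a little o of the preceding one. -/
def IsAsymptoticExpansion (a : ℕ → ℝ) (m : ℕ) (f : ℕ → ℕ → ℝ) : Prop :=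
  (∀ r, m ≤ r → (fun n => a n - ∑ k ∈ Finset.Icc m r, f k n) =O[atTop] f (r + 1)) ∧
  ∀ k, m ≤ k → f (k + 1) =o[atTop] f k

/-- A tournament: no loops, and any two distinct vertices are joined by exactly one directed
edge. -/
def Digraph.IsTournament {V : Type*} (T : Digraph V) : Prop :=
  (∀ v, ¬ T.Adj v v) ∧ ∀ v w, v ≠ w → (T.Adj v w ↔ ¬ T.Adj w v)

/-- The vertices can be partitioned into two nonempty parts `A` and `B` such that every edge
between `a ∈ A` and `b ∈ B` goes from `a` to `b`. For tournaments, where `a` and `b` are joined by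
exactly one edge, this says that `a → b` is an edge. -/
def Digraph.IsReducibleTournament {V : Type*} (T : Digraph V) : Prop :=
  T.IsTournament ∧ ∃ A B : Set V, A.Nonempty ∧ B.Nonempty ∧ Disjoint A B ∧ A ∪ B = Set.univ ∧
    ∀ a ∈ A, ∀ b ∈ B, T.Adj a b

/-- A tournament that is not reducible. -/
def Digraph.IsIrreducibleTournament {V : Type*} (T : Digraph V) : Prop :=
  T.IsTournament ∧ ¬ T.IsReducibleTournament

/-- The number of labeled irreducible tournaments of size `k`. -/
noncomputable def numIrreducibleTournaments (k : ℕ) : ℕ :=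
  Nat.card {T : Digraph (Fin k) // T.IsIrreducibleTournament}

/-- The probability that a uniformly random labeled simple graph with `n` vertices is connected. -/
noncomputable def probConnected (n : ℕ) : ℝ :=
  (Nat.card {G : SimpleGraph (Fin n) // G.Connected} : ℝ) / (Nat.card (SimpleGraph (Fin n)) : ℝ)

/-- The terms of the expansion of `probConnected`: the term of index `0` is the constant `1`, and
the term of index `k ≥ 1` is `- it_k * C(n, k) * 2 ^ (k (k + 1) / 2) / 2 ^ (k n)`. The division in
the exponent is exact. -/
noncomputable def connectedTerm (k n : ℕ) : ℝ :=
  if k = 0 then 1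
  else -((numIrreducibleTournaments k : ℝ) * (n.choose k : ℝ) *
    ((2 : ℝ) ^ (k * (k + 1) / 2) / (2 : ℝ) ^ (k * n)))

/-! ### Graphs, decomposed by the component of a marked vertex. -/

section Graphs

variable {V W : Type*}

/-! Let T be the exponential generating function of 2 ^ C(n, 2), which counts graphs and tournaments
alike, and let D = X d/dX. Removing the initial irreducible component of a tournament gives T = 1 +
I T, with I the series of irreducible tournaments, so U = 1/T equals 1 - I
(`graphs_mul_invGraphCoeff`). Removing the component of a marked vertex gives DT = DC · T for the
series C of connected graphs (`eulerDerivative_graphs`), hence DC = DT · U, with no need for a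
logarithm. This is how irreducible tournaments enter the count of connected graphs.

Let L be U truncated below degree m. The coefficients of T L, rescaled by n! / 2 ^ C(n, 2), are the
partial sums of the expansion, so C - T L has to be bounded. Call a series tame if its coefficients
are at most a polynomial times 2 ^ C(n, 2) / n!. If two tame series are divisible by X ^ m, their
product is X ^ m times a tame series (`HasGraphGrowth.exists_mul_eq_X_pow_mul`). Together with T U =
1 this makes DC - D(T L) equal to X ^ m h plus a polynomial, with h tame
(`exists_eulerDerivative_mul_sub_eq`). For large n only h at index n - m is left, which gives a
relative error 2 ^ (-m n) up to a polynomial factor. Expanding one term further than needed absorbs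
that factor (`isBigO_probConnected_sub`). -/

/-- The number of connected simple graphs on `Fin k`. -/
noncomputable def numConnectedGraphs (k : ℕ) : ℕ :=
  Nat.card {G : SimpleGraph (Fin k) // G.Connected}

theorem natCard_simpleGraph [Fintype V] [DecidableEq V] :
    Nat.card (SimpleGraph V) = 2 ^ (Fintype.card V).choose 2 := by
  have e : SimpleGraph V ≃ Set {e : Sym2 V // ¬ e.IsDiag} :=
    { toFun := fun G => {e | e.1 ∈ G.edgeSet}
      invFun := fun s => SimpleGraph.fromEdgeSet (Subtype.val '' s)
      left_inv := by
        intro G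
        ext a b
        simp only [SimpleGraph.fromEdgeSet_adj, Set.mem_image, Set.mem_ofPred_eq, Subtype.exists,
          exists_and_left, exists_prop, exists_eq_right_right, SimpleGraph.mem_edgeSet,
          Sym2.mk_isDiag_iff]
        exact ⟨fun h => h.1.1, fun h => ⟨⟨h, h.ne⟩, h.ne⟩⟩
      right_inv := by
        intro s
        ext ⟨e, he⟩
        simp [SimpleGraph.edgeSet_fromEdgeSet, he] }
  rw [Nat.card_congr e, Nat.card_eq_fintype_card, Fintype.card_set, Sym2.card_subtype_not_diag]

theorem natCard_connected_congr (e : V ≃ W) :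
    Nat.card {G : SimpleGraph V // G.Connected} = Nat.card {G : SimpleGraph W // G.Connected} :=
  Nat.card_congr <| e.simpleGraph.subtypeEquiv fun G =>
    (SimpleGraph.Iso.comap e.symm G).symm.connected_iff

/-- The set `S` is the vertex set of a connected component of `G`. -/
def SimpleGraph.IsComponentSupport (G : SimpleGraph V) (S : Finset V) : Prop :=
  (G.induce (S : Set V)).Connected ∧ ∀ a ∈ S, ∀ b ∉ S, ¬ G.Adj a b

theorem SimpleGraph.existsUnique_isComponentSupport [Fintype V] (G : SimpleGraph V) (v : V) :
    ∃! S : Finset V, v ∈ S ∧ G.IsComponentSupport S := by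
  classical
  refine ⟨(G.connectedComponentMk v).supp.toFinset, ⟨by simp, ?_, ?_⟩, ?_⟩
  · rw [Set.coe_toFinset]
    exact (G.connectedComponentMk v).connected_toSimpleGraph
  · intro a ha b hb hab
    simp only [Set.mem_toFinset, SimpleGraph.ConnectedComponent.mem_supp_iff] at ha hb
    exact hb ((SimpleGraph.ConnectedComponent.sound hab.symm.reachable).trans ha)
  · rintro S ⟨hv, hS, hout⟩
    ext w
    simp only [Set.mem_toFinset, SimpleGraph.ConnectedComponent.mem_supp_iff,
      SimpleGraph.ConnectedComponent.eq]
    constructor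
    · intro hw
      exact (hS.preconnected ⟨w, hw⟩ ⟨v, hv⟩).map (SimpleGraph.Embedding.induce _).toHom
    · rintro ⟨p⟩
      induction p with
      | nil => exact hv
      | cons h p ih =>
        by_contra hu
        exact hout _ (ih hv) _ hu h.symm

/-- No edge crosses between `S` and its complement, so the graph amounts to a connected graph on `S`
and an arbitrary graph on the rest. -/
theorem natCard_isComponentSupport [Fintype V] (S : Finset V) :
    Nat.card {G : SimpleGraph V // G.IsComponentSupport S} =
      numConnectedGraphs S.card * 2 ^ (Fintype.card V - S.card).choose 2 := by
  classical
  have key : Nat.card {G : SimpleGraph V // G.IsComponentSupport S} =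
      Nat.card ({G : SimpleGraph (S : Set V) // G.Connected} ×
        SimpleGraph ((S : Set V)ᶜ : Set V)) := by
    refine Nat.card_eq_of_bijective
      (fun G => (⟨G.1.induce (S : Set V), G.2.1⟩, G.1.induce ((S : Set V)ᶜ))) ⟨?_, ?_⟩
    · rintro ⟨G, hG⟩ ⟨H, hH⟩ h
      simp only [Prod.mk.injEq, Subtype.mk.injEq] at h
      obtain ⟨h1, h2⟩ := h
      apply Subtype.ext
      ext a b
      show G.Adj a b ↔ H.Adj a b
      by_cases ha : a ∈ S <;> by_cases hb : b ∈ S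
      · exact iff_of_eq (congrArg (fun K => K.Adj ⟨a, ha⟩ ⟨b, hb⟩) h1)
      · exact iff_of_false (hG.2 a ha b hb) (hH.2 a ha b hb)
      · exact iff_of_false (fun h => hG.2 b hb a ha h.symm) (fun h => hH.2 b hb a ha h.symm)
      · exact iff_of_eq (congrArg (fun K => K.Adj ⟨a, ha⟩ ⟨b, hb⟩) h2)
    · rintro ⟨⟨G, hG⟩, H⟩
      let K : SimpleGraph V :=
        { Adj := fun a b => (∃ ha hb, G.Adj ⟨a, ha⟩ ⟨b, hb⟩) ∨ ∃ ha hb, H.Adj ⟨a, ha⟩ ⟨b, hb⟩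
          symm := ⟨by
            rintro a b (⟨ha, hb, h⟩ | ⟨ha, hb, h⟩)
            · exact Or.inl ⟨hb, ha, h.symm⟩
            · exact Or.inr ⟨hb, ha, h.symm⟩⟩
          loopless := ⟨by
            rintro a (⟨ha, hb, h⟩ | ⟨ha, hb, h⟩)
            · exact G.loopless.irrefl _ h
            · exact H.loopless.irrefl _ h⟩ }
      have hK : K.induce (S : Set V) = G := by
        ext ⟨a, ha⟩ ⟨b, hb⟩
        exact ⟨fun h => h.elim (fun ⟨_, _, h⟩ => h) (fun ⟨h, _, _⟩ => absurd ha h),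
          fun h => Or.inl ⟨ha, hb, h⟩⟩
      have hK' : K.induce ((S : Set V)ᶜ) = H := by
        ext ⟨a, ha⟩ ⟨b, hb⟩
        exact ⟨fun h => h.elim (fun ⟨h, _, _⟩ => absurd h ha) (fun ⟨_, _, h⟩ => h),
          fun h => Or.inr ⟨ha, hb, h⟩⟩
      refine ⟨⟨K, by rw [hK]; exact hG, ?_⟩, ?_⟩
      · rintro a ha b hb (⟨_, h, _⟩ | ⟨h, _, _⟩)
        · exact hb h
        · exact h ha
      · simp only [hK, hK']
  rw [key, Nat.card_prod, natCard_simpleGraph]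
  congr 1
  · apply natCard_connected_congr
    exact S.equivFin
  · congr 2
    rw [Fintype.card_compl_set]
    simp

/-- Double counting of pairs of a graph and a marked vertex, sorted by the component containing the
mark; the factor `k` places the mark inside it. -/
theorem mul_card_simpleGraph_eq_sum (n : ℕ) :
    n * 2 ^ n.choose 2 = ∑ k ∈ Finset.range (n + 1),
      n.choose k * (k * numConnectedGraphs k * 2 ^ (n - k).choose 2) := by
  classical
  have h1 : ∀ G : SimpleGraph (Fin n),
      (∑ S : Finset (Fin n), if G.IsComponentSupport S then S.card else 0) = n := by
    intro G
    have h2 : ∀ v : Fin n,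
        (∑ S : Finset (Fin n), if v ∈ S ∧ G.IsComponentSupport S then 1 else 0) = 1 := by
      intro v
      obtain ⟨S, hS, hS'⟩ := G.existsUnique_isComponentSupport v
      rw [Finset.sum_eq_single S, if_pos hS]
      · intro S' _ hne
        exact if_neg fun h => hne (hS' S' h)
      · simp
    calc (∑ S : Finset (Fin n), if G.IsComponentSupport S then S.card else 0)
        = ∑ S : Finset (Fin n), ∑ v : Fin n,
            if v ∈ S ∧ G.IsComponentSupport S then 1 else 0 := by
          refine Finset.sum_congr rfl fun S _ => ?_
          by_cases h : G.IsComponentSupport S <;> simp [h]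
      _ = ∑ v : Fin n, 1 := by
          rw [Finset.sum_comm]
          exact Finset.sum_congr rfl fun v _ => h2 v
      _ = n := by simp
  have h3 : ∀ S : Finset (Fin n),
      (∑ G : SimpleGraph (Fin n), if G.IsComponentSupport S then S.card else 0) =
        S.card * numConnectedGraphs S.card * 2 ^ (n - S.card).choose 2 := by
    intro S
    rw [← Finset.sum_filter, Finset.sum_const, smul_eq_mul, mul_comm, mul_assoc]
    congr 1
    have := natCard_isComponentSupport S
    rw [Fintype.card_fin] at this
    rw [← this, Nat.card_eq_fintype_card, Fintype.card_subtype]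
  have h4 : n * 2 ^ n.choose 2 = ∑ G : SimpleGraph (Fin n), n := by
    have := natCard_simpleGraph (V := Fin n)
    rw [Fintype.card_fin, Nat.card_eq_fintype_card] at this
    simp only [Finset.sum_const, Finset.card_univ, this, smul_eq_mul, mul_comm]
  rw [h4, ← Finset.sum_congr rfl fun G _ => h1 G, Finset.sum_comm,
    Finset.sum_congr rfl fun S _ => h3 S, ← Finset.powerset_univ,
    Finset.sum_powerset_apply_card
      (fun k => k * numConnectedGraphs k * 2 ^ (n - k).choose 2)]
  simp

end Graphs

/-! ### Tournaments, decomposed by their initial irreducible component. -/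

section Tournaments

variable {V W : Type*}

/-- The digraph on `W` obtained by pulling `T` back along `f`. -/
def Digraph.pullback (f : W → V) (T : Digraph V) : Digraph W :=
  ⟨fun a b => T.Adj (f a) (f b)⟩

theorem Digraph.IsTournament.asymm {T : Digraph V} (h : T.IsTournament) {v w : V}
    (hvw : T.Adj v w) : ¬ T.Adj w v := by
  by_cases e : v = w
  · subst e; exact h.1 v
  · exact (h.2 v w e).1 hvw

theorem Digraph.IsTournament.pullback {T : Digraph V} (h : T.IsTournament) {f : W → V}
    (hf : f.Injective) : (T.pullback f).IsTournament :=
  ⟨fun v => h.1 (f v), fun _ _ hvw => h.2 _ _ fun e => hvw (hf e)⟩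

theorem Digraph.isIrreducibleTournament_iff {T : Digraph V} :
    T.IsIrreducibleTournament ↔ T.IsTournament ∧
      ∀ A : Set V, A.Nonempty → (∃ b, b ∉ A) → ∃ a ∈ A, ∃ b ∉ A, ¬ T.Adj a b := by
  constructor
  · rintro ⟨hT, hred⟩
    refine ⟨hT, fun A hA hA' => ?_⟩
    by_contra! hcon
    exact hred ⟨hT, A, Aᶜ, hA, hA', disjoint_compl_right, Set.union_compl_self A, hcon⟩
  · rintro ⟨hT, h⟩
    refine ⟨hT, ?_⟩
    rintro ⟨-, A, B, hA, ⟨b, hb⟩, hdisj, hunion, hAB⟩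
    obtain ⟨a, ha, c, hc, hac⟩ := h A hA ⟨b, fun hbA => Set.disjoint_left.1 hdisj hbA hb⟩
    have hc' : c ∈ A ∪ B := hunion ▸ Set.mem_univ c
    exact hac (hAB a ha c (hc'.resolve_left hc))

theorem Digraph.IsIrreducibleTournament.pullback_equiv {T : Digraph V}
    (h : T.IsIrreducibleTournament) (e : W ≃ V) : (T.pullback e).IsIrreducibleTournament := by
  rw [Digraph.isIrreducibleTournament_iff] at h ⊢
  refine ⟨h.1.pullback e.injective, ?_⟩
  rintro A ⟨a, ha⟩ ⟨b, hb⟩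
  obtain ⟨x, hx, y, hy, hxy⟩ := h.2 (e.symm ⁻¹' A) ⟨e a, by simpa using ha⟩ ⟨e b, by simpa using hb⟩
  exact ⟨e.symm x, hx, e.symm y, hy, by simpa [Digraph.pullback] using hxy⟩

theorem natCard_irreducibleTournament_congr (e : V ≃ W) :
    Nat.card {T : Digraph V // T.IsIrreducibleTournament} =
      Nat.card {T : Digraph W // T.IsIrreducibleTournament} :=
  Nat.card_congr
    { toFun := fun T => ⟨T.1.pullback e.symm, T.2.pullback_equiv e.symm⟩
      invFun := fun T => ⟨T.1.pullback e, T.2.pullback_equiv e⟩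
      left_inv := fun T => by simp [Digraph.pullback]
      right_inv := fun T => by simp [Digraph.pullback] }

/-- Relative to a fixed linear order, a tournament is the graph of those pairs that are oriented
upwards. -/
theorem natCard_tournament [Fintype V] :
    Nat.card {T : Digraph V // T.IsTournament} = 2 ^ (Fintype.card V).choose 2 := by
  classical
  let _ : LinearOrder V := LinearOrder.lift' (Fintype.equivFin V) (Fintype.equivFin V).injective
  rw [← natCard_simpleGraph]
  exact Nat.card_congr
    { toFun := fun T =>
        { Adj := fun a b => (a < b ∧ T.1.Adj a b) ∨ (b < a ∧ T.1.Adj b a)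
          symm := ⟨fun a b h => h.symm⟩
          loopless := ⟨fun a h => h.elim (fun h => lt_irrefl _ h.1) (fun h => lt_irrefl _ h.1)⟩ }
      invFun := fun G =>
        ⟨⟨fun a b => (a < b ∧ G.Adj a b) ∨ (b < a ∧ ¬ G.Adj b a)⟩, by
          refine ⟨fun v => by simp, fun v w hvw => ?_⟩
          rcases lt_or_gt_of_ne hvw with h | h <;> simp [h, h.not_gt]⟩
      left_inv := by
        rintro ⟨T, hT⟩
        apply Subtype.ext
        ext a b
        rcases lt_trichotomy a b with h | rfl | h
        · simp [h, h.not_gt]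
        · simp [hT.1]
        · simp [h, h.not_gt, hT.2 a b h.ne']
      right_inv := by
        intro G
        ext a b
        rcases lt_trichotomy a b with h | rfl | h
        · simp [h, h.not_gt]
        · simp
        · simp [h, h.not_gt, G.adj_comm] }

/-- The set `S` is the initial irreducible component of `T`: it is nonempty, the tournament induced
on it is irreducible, and all edges between `S` and its complement leave `S`. -/
def Digraph.IsInitialComponent (T : Digraph V) (S : Finset V) : Prop :=
  S.Nonempty ∧ (T.pullback (Subtype.val : {x // x ∈ S} → V)).IsIrreducibleTournament ∧
    ∀ a ∈ S, ∀ b ∉ S, T.Adj a b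

/-- A vertex of `S` outside `S'` forces `S' ⊆ S`, since a vertex of `S'` outside `S` would be joined
to it in both directions. Then `S'` is a proper part of `S` dominating the rest, against
irreducibility. -/
theorem Digraph.IsInitialComponent.subset {T : Digraph V} (hT : T.IsTournament)
    {S S' : Finset V} (h : T.IsInitialComponent S) (h' : T.IsInitialComponent S') : S ⊆ S' := by
  intro a ha
  by_contra ha'
  have hsub : S' ⊆ S := fun b hb => by
    by_contra hb'
    exact hT.asymm (h.2.2 a ha b hb') (h'.2.2 b hb a ha')
  obtain ⟨c, hc⟩ := h'.1
  obtain ⟨x, hx, y, hy, hxy⟩ := (Digraph.isIrreducibleTournament_iff.1 h.2.1).2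
    {x | x.1 ∈ S'} ⟨⟨c, hsub hc⟩, hc⟩ ⟨⟨a, ha⟩, ha'⟩
  exact hxy (h'.2.2 x hx y hy)

theorem Digraph.IsTournament.existsUnique_isInitialComponent [Fintype V] [Nonempty V]
    {T : Digraph V} (hT : T.IsTournament) : ∃! S : Finset V, T.IsInitialComponent S := by
  classical
  suffices h : ∃ S : Finset V, T.IsInitialComponent S by
    obtain ⟨S, hS⟩ := h
    exact ⟨S, hS, fun S' hS' => (hS'.subset hT hS).antisymm (hS.subset hT hS')⟩
  -- A smallest nonempty dominating set works: if it were reducible, its dominating part would be a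
  -- smaller one.
  obtain ⟨S, hS, hmin⟩ := Finset.exists_min_image
    (Finset.univ.filter fun S : Finset V => S.Nonempty ∧ ∀ a ∈ S, ∀ b ∉ S, T.Adj a b)
    Finset.card ⟨Finset.univ, by simp⟩
  simp only [Finset.mem_filter, Finset.mem_univ, true_and] at hS hmin
  refine ⟨S, hS.1, ?_, hS.2⟩
  rw [Digraph.isIrreducibleTournament_iff]
  refine ⟨hT.pullback Subtype.val_injective, ?_⟩
  rintro A ⟨a, ha⟩ ⟨b, hb⟩
  by_contra! hcon
  let S' : Finset V := S.filter fun x => ∃ h : x ∈ S, ⟨x, h⟩ ∈ A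
  have hlt : S'.card < S.card :=
    Finset.card_lt_card (Finset.filter_ssubset.2 ⟨b.1, b.2, fun ⟨_, h⟩ => hb h⟩)
  refine absurd (hmin S' ⟨⟨a.1, Finset.mem_filter.2 ⟨a.2, a.2, ha⟩⟩, ?_⟩) hlt.not_ge
  intro x hx y hy
  obtain ⟨hxS, _, hxA⟩ := Finset.mem_filter.1 hx
  by_cases hyS : y ∈ S
  · exact hcon ⟨x, hxS⟩ hxA ⟨y, hyS⟩ fun h => hy (Finset.mem_filter.2 ⟨hyS, hyS, h⟩)
  · exact hS.2 x hxS y hyS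

theorem natCard_isInitialComponent [Fintype V] {S : Finset V} (hS : S.Nonempty) :
    Nat.card {T : Digraph V // T.IsTournament ∧ T.IsInitialComponent S} =
      numIrreducibleTournaments S.card * 2 ^ (Fintype.card V - S.card).choose 2 := by
  classical
  have key : Nat.card {T : Digraph V // T.IsTournament ∧ T.IsInitialComponent S} =
      Nat.card ({T : Digraph {x // x ∈ S} // T.IsIrreducibleTournament} ×
        {T : Digraph {x // x ∉ S} // T.IsTournament}) := by
    refine Nat.card_eq_of_bijective
      (fun T => (⟨T.1.pullback Subtype.val, T.2.2.2.1⟩,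
        ⟨T.1.pullback Subtype.val, T.2.1.pullback Subtype.val_injective⟩)) ⟨?_, ?_⟩
    · rintro ⟨G, hG, hG'⟩ ⟨H, hH, hH'⟩ h
      simp only [Prod.mk.injEq, Subtype.mk.injEq] at h
      obtain ⟨h1, h2⟩ := h
      apply Subtype.ext
      ext a b
      show G.Adj a b ↔ H.Adj a b
      by_cases ha : a ∈ S <;> by_cases hb : b ∈ S
      · exact iff_of_eq (congrArg (fun K => K.Adj ⟨a, ha⟩ ⟨b, hb⟩) h1)
      · exact iff_of_true (hG'.2.2 a ha b hb) (hH'.2.2 a ha b hb)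
      · exact iff_of_false (hG.asymm (hG'.2.2 b hb a ha)) (hH.asymm (hH'.2.2 b hb a ha))
      · exact iff_of_eq (congrArg (fun K => K.Adj ⟨a, ha⟩ ⟨b, hb⟩) h2)
    · rintro ⟨⟨G, hG⟩, ⟨H, hH⟩⟩
      let K : Digraph V :=
        { Adj := fun a b => (∃ ha hb, G.Adj ⟨a, ha⟩ ⟨b, hb⟩) ∨ (∃ ha hb, H.Adj ⟨a, ha⟩ ⟨b, hb⟩) ∨
            (a ∈ S ∧ b ∉ S) }
      have hK : K.pullback (Subtype.val : {x // x ∈ S} → V) = G := by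
        ext ⟨a, ha⟩ ⟨b, hb⟩
        simp [K, Digraph.pullback]
      have hK' : K.pullback (Subtype.val : {x // x ∉ S} → V) = H := by
        ext ⟨a, ha⟩ ⟨b, hb⟩
        simp [K, Digraph.pullback, ha, hb]
      have hKT : K.IsTournament := by
        constructor
        · intro v
          by_cases hv : v ∈ S
          · simpa [K, hv] using hG.1.1 _
          · simpa [K, hv] using hH.1 _
        · intro v w hvw
          by_cases hv : v ∈ S <;> by_cases hw : w ∈ S
          · simpa [K, hv, hw] using hG.1.2 ⟨v, hv⟩ ⟨w, hw⟩ (by simpa using hvw)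
          · simp [K, hv, hw]
          · simp [K, hv, hw]
          · simpa [K, hv, hw] using hH.2 ⟨v, hv⟩ ⟨w, hw⟩ (by simpa using hvw)
      refine ⟨⟨K, hKT, hS, by rw [hK]; exact hG, fun a ha b hb => Or.inr (Or.inr ⟨ha, hb⟩)⟩, ?_⟩
      simp only [hK, hK']
  rw [key, Nat.card_prod, natCard_tournament]
  congr 1
  · exact natCard_irreducibleTournament_congr S.equivFin
  · rw [Fintype.card_subtype_compl, Fintype.card_coe]

/-- Tournaments are sorted by their unique initial component. The guard at `k = 0` is needed because
the empty tournament is irreducible under the definition. -/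
theorem card_tournament_eq_sum {n : ℕ} (hn : n ≠ 0) :
    2 ^ n.choose 2 = ∑ k ∈ Finset.range (n + 1), n.choose k *
      if k = 0 then 0 else numIrreducibleTournaments k * 2 ^ (n - k).choose 2 := by
  classical
  have : Nonempty (Fin n) := ⟨⟨0, Nat.pos_of_ne_zero hn⟩⟩
  have h1 : ∀ T : {T : Digraph (Fin n) // T.IsTournament},
      (∑ S : Finset (Fin n), if T.1.IsInitialComponent S then 1 else 0) = 1 := by
    intro T
    obtain ⟨S, hS, hS'⟩ := T.2.existsUnique_isInitialComponent
    rw [Finset.sum_eq_single S, if_pos hS]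
    · intro S' _ hne
      exact if_neg fun h => hne (hS' S' h)
    · simp
  have h3 : ∀ S : Finset (Fin n),
      (∑ T : {T : Digraph (Fin n) // T.IsTournament}, if T.1.IsInitialComponent S then 1 else 0) =
        if S.card = 0 then 0
        else numIrreducibleTournaments S.card * 2 ^ (n - S.card).choose 2 := by
    intro S
    split_ifs with hS
    · exact Finset.sum_eq_zero fun T _ =>
        if_neg fun h => h.1.ne_empty (Finset.card_eq_zero.1 hS)
    · have := natCard_isInitialComponent (V := Fin n)
        (Finset.nonempty_iff_ne_empty.2 fun h => hS (Finset.card_eq_zero.2 h))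
      rw [Fintype.card_fin] at this
      rw [← this, Finset.sum_boole, ← Fintype.card_subtype, ← Nat.card_eq_fintype_card, Nat.cast_id]
      exact Nat.card_congr (Equiv.subtypeSubtypeEquivSubtypeInter Digraph.IsTournament
        fun T => T.IsInitialComponent S)
  have h4 : 2 ^ n.choose 2 = ∑ T : {T : Digraph (Fin n) // T.IsTournament}, 1 := by
    have := natCard_tournament (V := Fin n)
    rw [Fintype.card_fin, Nat.card_eq_fintype_card] at this
    simp [← this]
  rw [h4, ← Finset.sum_congr rfl fun G _ => h1 G, Finset.sum_comm,
    Finset.sum_congr rfl fun S _ => h3 S, ← Finset.powerset_univ,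
    Finset.sum_powerset_apply_card
      (fun k => if k = 0 then 0 else numIrreducibleTournaments k * 2 ^ (n - k).choose 2)]
  simp

theorem numIrreducibleTournaments_one : numIrreducibleTournaments 1 = 1 := by
  have := card_tournament_eq_sum (n := 1) (by norm_num)
  simp [Finset.sum_range_succ] at this
  exact this.symm

theorem numIrreducibleTournaments_two : numIrreducibleTournaments 2 = 0 := by
  have := card_tournament_eq_sum (n := 2) (by norm_num)
  simp [Finset.sum_range_succ, numIrreducibleTournaments_one, Nat.choose] at this
  exact this

theorem numIrreducibleTournaments_three : numIrreducibleTournaments 3 = 2 := by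
  have := card_tournament_eq_sum (n := 3) (by norm_num)
  simp [Finset.sum_range_succ, numIrreducibleTournaments_one, numIrreducibleTournaments_two,
    Nat.choose] at this
  omega

theorem numIrreducibleTournaments_four : numIrreducibleTournaments 4 = 24 := by
  have := card_tournament_eq_sum (n := 4) (by norm_num)
  simp [Finset.sum_range_succ, numIrreducibleTournaments_one, numIrreducibleTournaments_two,
    numIrreducibleTournaments_three, Nat.choose] at this
  omega

theorem numIrreducibleTournaments_le (k : ℕ) :
    numIrreducibleTournaments k ≤ 2 ^ k.choose 2 := by
  classical
  have := natCard_tournament (V := Fin k)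
  rw [Fintype.card_fin] at this
  rw [← this]
  exact Nat.card_le_card_of_injective
    (fun T : {T : Digraph (Fin k) // T.IsIrreducibleTournament} =>
      (⟨T.1, T.2.1⟩ : {T : Digraph (Fin k) // T.IsTournament}))
    fun T T' h => Subtype.ext (by simpa using h)

/-- The tournament `0 → 1 → ⋯ → k - 1` in which all other edges point backwards is irreducible
for `k ≥ 3`. -/
theorem numIrreducibleTournaments_pos {k : ℕ} (hk : 3 ≤ k) : 0 < numIrreducibleTournaments k := by
  classical
  let T : Digraph (Fin k) := ⟨fun a b => b.1 = a.1 + 1 ∨ b.1 + 1 < a.1⟩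
  have hT : T.IsTournament := by
    refine ⟨fun v => by simp [T], fun v w hvw => ?_⟩
    have : v.1 ≠ w.1 := fun h => hvw (Fin.ext h)
    simp only [T]
    omega
  have hirr : T.IsIrreducibleTournament := by
    rw [Digraph.isIrreducibleTournament_iff]
    refine ⟨hT, ?_⟩
    rintro A ⟨a, ha⟩ ⟨b, hb⟩
    by_contra! hcon
    have hstep : ∀ i (hi : i + 1 < k), (⟨i + 1, hi⟩ : Fin k) ∈ A → (⟨i, by omega⟩ : Fin k) ∈ A := by
      intro i hi h
      by_contra h'
      exact hT.asymm (hcon _ h _ h') (Or.inl rfl)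
    have hdown : ∀ i j (hj : j < k) (hij : i ≤ j), (⟨j, hj⟩ : Fin k) ∈ A →
        (⟨i, by omega⟩ : Fin k) ∈ A := by
      intro i j hj hij
      induction j, hij using Nat.le_induction with
      | base => exact id
      | succ j _ ih => exact fun h => ih (by omega) (hstep j hj h)
    have h0 : (⟨0, by omega⟩ : Fin k) ∈ A := hdown 0 a.1 a.2 (Nat.zero_le _) ha
    have hlast : (⟨k - 1, by omega⟩ : Fin k) ∈ A := by
      by_contra h'
      exact hT.asymm (hcon _ h0 _ h') (Or.inr (by simp only; omega))
    exact hb (hdown b.1 (k - 1) (by omega) (by omega) hlast)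
  have : Nonempty {T : Digraph (Fin k) // T.IsIrreducibleTournament} := ⟨⟨T, hirr⟩⟩
  exact Nat.card_pos

end Tournaments

/-! ### Binomial estimates against powers of two. -/

section PowerSeries

open PowerSeries
open scoped Nat

theorem add_choose_two (x y : ℕ) : (x + y).choose 2 = x.choose 2 + y.choose 2 + x * y := by
  induction y with
  | zero => simp
  | succ y ih =>
    rw [← add_assoc, Nat.choose_succ_succ' (x + y) 1, Nat.choose_succ_succ' y 1, ih]
    simp only [Nat.choose_one_right]
    ring

/-- If `a` or `b` vanishes, the binomial is polynomial of degree `m`. Otherwise `a + b ≤ a * b + 1`,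
and the trivial bound by a power of two suffices. -/
theorem choose_le_mul_two_pow (m a b : ℕ) :
    (m + a + (m + b)).choose (m + a) ≤
      2 ^ (2 * m + 1) * (m + a + (m + b) + 1) ^ m * 2 ^ (a * b) := by
  have hpow : ∀ N, N.choose m ≤ (N + 1) ^ m := fun N =>
    (Nat.choose_le_pow N m).trans (Nat.pow_le_pow_left N.le_succ m)
  have hle : (m + a + (m + b) + 1) ^ m ≤
      2 ^ (2 * m + 1) * (m + a + (m + b) + 1) ^ m := Nat.le_mul_of_pos_left _ (by positivity)
  rcases Nat.eq_zero_or_pos a with rfl | ha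
  · simpa using (hpow _).trans hle
  rcases Nat.eq_zero_or_pos b with rfl | hb
  · rw [add_zero m, Nat.choose_symm_add]
    simpa using (hpow _).trans hle
  · have hab : a + b ≤ a * b + 1 := by nlinarith
    calc (m + a + (m + b)).choose (m + a) ≤ 2 ^ (m + a + (m + b)) := Nat.choose_le_two_pow _ _
      _ ≤ 2 ^ (2 * m + 1 + a * b) := Nat.pow_le_pow_right (by norm_num) (by omega)
      _ = 2 ^ (2 * m + 1) * 2 ^ (a * b) := pow_add _ _ _
      _ ≤ 2 ^ (2 * m + 1) * (m + a + (m + b) + 1) ^ m * 2 ^ (a * b) :=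
        Nat.mul_le_mul_right _ (Nat.le_mul_of_pos_right _ (by positivity))

/-- With `i = m + a` and `j = m + b`, moving away from the extreme splittings `a = 0` or `b = 0`
costs exactly the factor `2 ^ (a * b)`, which pays for the binomial. -/
theorem choose_mul_two_pow_choose_two_le {m i j n : ℕ} (hi : m ≤ i) (hj : m ≤ j)
    (hn : i + j = n + m) :
    (n + m).choose i * (2 ^ i.choose 2 * 2 ^ j.choose 2) ≤
      2 ^ (2 * m + 1 + m.choose 2) * (n + m + 1) ^ m * 2 ^ n.choose 2 := by
  obtain ⟨a, rfl⟩ := Nat.exists_eq_add_of_le hi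
  obtain ⟨b, rfl⟩ := Nat.exists_eq_add_of_le hj
  obtain rfl : n = m + a + b := by omega
  rw [← hn]
  have key : (m + a).choose 2 + (m + b).choose 2 + a * b = m.choose 2 + (m + a + b).choose 2 := by
    rw [add_choose_two (m + a) b, add_choose_two m b]
    ring
  calc _ ≤ 2 ^ (2 * m + 1) * (m + a + (m + b) + 1) ^ m * 2 ^ (a * b) *
        (2 ^ (m + a).choose 2 * 2 ^ (m + b).choose 2) :=
        Nat.mul_le_mul_right _ (choose_le_mul_two_pow m a b)
    _ = 2 ^ (2 * m + 1) * (m + a + (m + b) + 1) ^ m *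
        2 ^ ((m + a).choose 2 + (m + b).choose 2 + a * b) := by ring
    _ = _ := by rw [key]; ring

/-! ### The algebra of series with graph growth. -/

/-- The exponential coefficients of `f` are bounded by a polynomial in `n` times the number
`2 ^ (n choose 2)` of graphs on `n` vertices. -/
def HasGraphGrowth (f : ℝ⟦X⟧) : Prop :=
  ∃ (M : ℕ) (K : ℝ), 0 ≤ K ∧
    ∀ n, |coeff n f| * n ! ≤ K * (n + 1 : ℝ) ^ M * 2 ^ n.choose 2

/-- Divisibility of both factors leaves only the terms with `m ≤ i` and `m ≤ j` in the convolution,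
and each of these is of size `2 ^ n.choose 2` up to a polynomial, although the total degree is `n +
m`. -/
theorem HasGraphGrowth.exists_mul_eq_X_pow_mul {f g : ℝ⟦X⟧} (hf : HasGraphGrowth f)
    (hg : HasGraphGrowth g) {m : ℕ} (hmf : X ^ m ∣ f) (hmg : X ^ m ∣ g) :
    ∃ h, HasGraphGrowth h ∧ f * g = X ^ m * h := by
  obtain ⟨h, hh⟩ := hmf.mul_right g
  refine ⟨h, ?_, hh⟩
  have hcoeff : ∀ n, coeff n h = coeff (n + m) (f * g) := fun n => by
    rw [hh, coeff_X_pow_mul]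
  rw [X_pow_dvd_iff] at hmf hmg
  obtain ⟨M, K, hK, hf⟩ := hf
  obtain ⟨M', K', hK', hg⟩ := hg
  set A : ℝ := 2 ^ (2 * m + 1 + m.choose 2) with hA
  -- In the exponent, `1` counts the terms of the convolution and `m` comes from the binomial
  -- estimate. The power of `m + 1` converts `n + m + 1` into `n + 1`.
  refine ⟨1 + M + M' + m, K * K' * A * (m + 1) ^ (1 + M + M' + m), by positivity, fun n => ?_⟩
  set N : ℝ := (n : ℝ) + m + 1 with hN
  have hterm : ∀ p ∈ Finset.HasAntidiagonal.antidiagonal (n + m),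
      |coeff p.1 f * coeff p.2 g| * n ! ≤
        K * K' * A * N ^ (M + M' + m) * 2 ^ n.choose 2 := by
    rintro ⟨i, j⟩ hij
    rw [Finset.HasAntidiagonal.mem_antidiagonal] at hij
    simp only at hij ⊢
    by_cases hi : i < m
    · rw [hmf i hi, zero_mul, abs_zero, zero_mul]
      positivity
    by_cases hj : j < m
    · rw [hmg j hj, mul_zero, abs_zero, zero_mul]
      positivity
    have h1 : ((n ! : ℕ) : ℝ) ≤ (n + m).choose i * (i ! * j !) := by
      have := Nat.choose_mul_factorial_mul_factorial (show i ≤ n + m by omega)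
      rw [show n + m - i = j by omega] at this
      rw [← mul_assoc]
      exact_mod_cast this ▸ Nat.factorial_le (Nat.le_add_right n m)
    have h2 : ((n + m).choose i : ℝ) * (2 ^ i.choose 2 * 2 ^ j.choose 2) ≤
        A * N ^ m * 2 ^ n.choose 2 := by
      have := choose_mul_two_pow_choose_two_le (not_lt.1 hi) (not_lt.1 hj) hij
      rw [hA, hN]
      exact_mod_cast this
    have hi' : (i + 1 : ℝ) ^ M ≤ N ^ M := by
      refine pow_le_pow_left₀ (by positivity) ?_ M
      have : i ≤ n + m := by omega
      rw [hN]
      exact_mod_cast Nat.succ_le_succ this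
    have hj' : (j + 1 : ℝ) ^ M' ≤ N ^ M' := by
      refine pow_le_pow_left₀ (by positivity) ?_ M'
      have : j ≤ n + m := by omega
      rw [hN]
      exact_mod_cast Nat.succ_le_succ this
    calc |coeff i f * coeff j g| * n !
        ≤ |coeff i f * coeff j g| * ((n + m).choose i * (i ! * j !)) := by gcongr
      _ = (|coeff i f| * i !) * (|coeff j g| * j !) * (n + m).choose i := by
        rw [abs_mul]; ring
      _ ≤ (K * (i + 1 : ℝ) ^ M * 2 ^ i.choose 2) * (K' * (j + 1 : ℝ) ^ M' * 2 ^ j.choose 2) *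
          (n + m).choose i :=
        mul_le_mul_of_nonneg_right (mul_le_mul (hf i) (hg j) (by positivity) (by positivity))
          (by positivity)
      _ ≤ (K * N ^ M * 2 ^ i.choose 2) * (K' * N ^ M' * 2 ^ j.choose 2) *
          (n + m).choose i := by gcongr
      _ = K * K' * N ^ (M + M') * ((n + m).choose i * (2 ^ i.choose 2 * 2 ^ j.choose 2)) := by ring
      _ ≤ K * K' * N ^ (M + M') * (A * N ^ m * 2 ^ n.choose 2) := by gcongr
      _ = _ := by ring
  have hN' : N ≤ (m + 1) * (n + 1) := by
    have : (0 : ℝ) ≤ m * n := by positivity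
    rw [hN]
    linarith
  calc |coeff n h| * n !
      ≤ (∑ p ∈ Finset.HasAntidiagonal.antidiagonal (n + m), |coeff p.1 f * coeff p.2 g|) * n ! := by
        rw [hcoeff, coeff_mul]
        gcongr
        exact Finset.abs_sum_le_sum_abs _ _
    _ ≤ ∑ p ∈ Finset.HasAntidiagonal.antidiagonal (n + m),
          K * K' * A * N ^ (M + M' + m) * 2 ^ n.choose 2 := by
        rw [Finset.sum_mul]
        exact Finset.sum_le_sum hterm
    _ = K * K' * A * N ^ (1 + M + M' + m) * 2 ^ n.choose 2 := by
        rw [Finset.sum_const, Finset.Nat.card_antidiagonal, nsmul_eq_mul]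
        push_cast
        rw [hN]
        ring
    _ ≤ K * K' * A * ((m + 1) * (n + 1)) ^ (1 + M + M' + m) * 2 ^ n.choose 2 := by gcongr
    _ = _ := by rw [mul_pow]; ring

theorem HasGraphGrowth.of_le {f : ℝ⟦X⟧} (K : ℝ)
    (h : ∀ n, |coeff n f| * n ! ≤ K * 2 ^ n.choose 2) : HasGraphGrowth f := by
  refine ⟨0, K, ?_, fun n => by simpa using h n⟩
  have := h 0
  simp only [Nat.factorial_zero, Nat.cast_one, mul_one, Nat.choose_zero_succ, pow_zero] at this
  exact (abs_nonneg _).trans this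

theorem HasGraphGrowth.add {f g : ℝ⟦X⟧} (hf : HasGraphGrowth f) (hg : HasGraphGrowth g) :
    HasGraphGrowth (f + g) := by
  obtain ⟨M, K, hK, hf⟩ := hf
  obtain ⟨M', K', hK', hg⟩ := hg
  refine ⟨M + M', K + K', by positivity, fun n => ?_⟩
  have h1 : (1 : ℝ) ≤ n + 1 := by linarith [(Nat.cast_nonneg n : (0 : ℝ) ≤ n)]
  calc |coeff n (f + g)| * n ! ≤ (|coeff n f| + |coeff n g|) * n ! := by
        rw [map_add]
        gcongr
        exact abs_add_le _ _
    _ = |coeff n f| * n ! + |coeff n g| * n ! := by ring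
    _ ≤ K * (n + 1 : ℝ) ^ M * 2 ^ n.choose 2 + K' * (n + 1 : ℝ) ^ M' * 2 ^ n.choose 2 :=
        add_le_add (hf n) (hg n)
    _ ≤ K * (n + 1 : ℝ) ^ (M + M') * 2 ^ n.choose 2 +
        K' * (n + 1 : ℝ) ^ (M + M') * 2 ^ n.choose 2 := by
        gcongr <;> omega
    _ = _ := by ring

theorem hasGraphGrowth_monomial (d : ℕ) (a : ℝ) : HasGraphGrowth (monomial d a) := by
  refine .of_le (|a| * d !) fun n => ?_
  rw [coeff_monomial]
  split_ifs with h
  · subst h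
    exact le_mul_of_one_le_right (by positivity) (one_le_pow₀ (by norm_num))
  · simp only [abs_zero, zero_mul]
    positivity

/-- The algebra of power series with the growth of the generating function of graphs. -/
def graphGrowthSubalgebra : Subalgebra ℝ ℝ⟦X⟧ where
  carrier := {f | HasGraphGrowth f}
  mul_mem' {f g} hf hg := by
    obtain ⟨h, hh, e⟩ := HasGraphGrowth.exists_mul_eq_X_pow_mul hf hg (m := 0) (by simp) (by simp)
    rw [pow_zero, one_mul] at e
    exact e ▸ hh
  add_mem' hf hg := HasGraphGrowth.add hf hg
  algebraMap_mem' a := by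
    have := hasGraphGrowth_monomial 0 a
    rwa [monomial_zero_eq_C_apply] at this

theorem coe_mem_graphGrowthSubalgebra (p : Polynomial ℝ) :
    (p : ℝ⟦X⟧) ∈ graphGrowthSubalgebra := by
  induction p using Polynomial.induction_on' with
  | add p q hp hq =>
    rw [Polynomial.coe_add]
    exact add_mem hp hq
  | monomial n a =>
    rw [Polynomial.coe_monomial]
    exact hasGraphGrowth_monomial n a

/-- Dividing by `X ^ m` shifts coefficients and can destroy graph growth in general; a polynomial
quotient is still in the algebra. -/
theorem Polynomial.exists_coe_eq_X_pow_mul {p : Polynomial ℝ} {m : ℕ}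
    (h : (PowerSeries.X : ℝ⟦X⟧) ^ m ∣ (p : ℝ⟦X⟧)) :
    ∃ q : Polynomial ℝ, (p : ℝ⟦X⟧) = PowerSeries.X ^ m * (q : ℝ⟦X⟧) := by
  have h' : Polynomial.X ^ m ∣ p := by
    rw [PowerSeries.X_pow_dvd_iff] at h
    rw [Polynomial.X_pow_dvd_iff]
    exact fun d hd => by simpa using h d hd
  obtain ⟨q, rfl⟩ := h'
  exact ⟨q, by simp⟩

/-! ### The Euler derivation and the error of truncation. -/

/-- The Euler derivation `X * d/dX`. -/
noncomputable def eulerDerivative (f : ℝ⟦X⟧) : ℝ⟦X⟧ := X * d⁄dX ℝ f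

theorem coeff_eulerDerivative (f : ℝ⟦X⟧) (n : ℕ) :
    coeff n (eulerDerivative f) = n * coeff n f := by
  cases n with
  | zero => simp [eulerDerivative]
  | succ n => rw [eulerDerivative, coeff_succ_X_mul, coeff_derivative, mul_comm, Nat.cast_succ]

theorem eulerDerivative_sub (f g : ℝ⟦X⟧) :
    eulerDerivative (f - g) = eulerDerivative f - eulerDerivative g := by
  rw [eulerDerivative, map_sub, mul_sub]; rfl

theorem eulerDerivative_mul (f g : ℝ⟦X⟧) :
    eulerDerivative (f * g) = f * eulerDerivative g + g * eulerDerivative f := by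
  simp only [eulerDerivative, Derivation.leibniz, smul_eq_mul]
  ring

theorem eulerDerivative_coe (p : Polynomial ℝ) :
    eulerDerivative p = (Polynomial.X * Polynomial.derivative p : Polynomial ℝ) := by
  rw [eulerDerivative, derivative_coe, Polynomial.coe_mul, Polynomial.coe_X]

theorem X_pow_dvd_eulerDerivative {f : ℝ⟦X⟧} {m : ℕ} (h : X ^ m ∣ f) :
    X ^ m ∣ eulerDerivative f := by
  rw [X_pow_dvd_iff] at h ⊢
  intro d hd
  rw [coeff_eulerDerivative, h d hd, mul_zero]

theorem eulerDerivative_mem {f : ℝ⟦X⟧} (hf : f ∈ graphGrowthSubalgebra) :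
    eulerDerivative f ∈ graphGrowthSubalgebra := by
  obtain ⟨M, K, hK, hf⟩ := hf
  refine ⟨M + 1, K, hK, fun n => ?_⟩
  rw [coeff_eulerDerivative, abs_mul, Nat.abs_cast]
  calc n * |coeff n f| * n ! = n * (|coeff n f| * n !) := by ring
    _ ≤ (n + 1) * (K * (n + 1 : ℝ) ^ M * 2 ^ n.choose 2) :=
        mul_le_mul (by linarith) (hf n) (by positivity) (by positivity)
    _ = _ := by ring

/-- If `U` is the inverse of `T` and `P`, `L` are truncations of `T`, `U`, then
`T' U - (T L)' = T' (U - L) - T L'` is a polynomial up to an error divisible by `X ^ m`. -/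
theorem exists_eulerDerivative_mul_sub_eq {T U : ℝ⟦X⟧} (hT : T ∈ graphGrowthSubalgebra)
    (hU : U ∈ graphGrowthSubalgebra) (hTU : T * U = 1) {m : ℕ} {P L : Polynomial ℝ}
    (hP : X ^ m ∣ T - (P : ℝ⟦X⟧)) (hL : X ^ m ∣ U - (L : ℝ⟦X⟧)) :
    ∃ h ∈ graphGrowthSubalgebra, eulerDerivative T * U - eulerDerivative (T * (L : ℝ⟦X⟧)) =
      X ^ m * h - (P : ℝ⟦X⟧) * eulerDerivative (L : ℝ⟦X⟧) := by
  have hPm := coe_mem_graphGrowthSubalgebra P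
  have hLm := coe_mem_graphGrowthSubalgebra L
  have ha : T - (P : ℝ⟦X⟧) ∈ graphGrowthSubalgebra := sub_mem hT hPm
  have hH : U - (L : ℝ⟦X⟧) ∈ graphGrowthSubalgebra := sub_mem hU hLm
  have hdvd : (X : ℝ⟦X⟧) ^ m ∣ ((P * L - 1 : Polynomial ℝ) : ℝ⟦X⟧) := by
    have : ((P * L - 1 : Polynomial ℝ) : ℝ⟦X⟧) =
        -((T - (P : ℝ⟦X⟧)) * (L : ℝ⟦X⟧) + T * (U - (L : ℝ⟦X⟧))) := by
      push_cast
      linear_combination hTU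
    rw [this]
    exact ((hP.mul_right _).add (hL.mul_left _)).neg_right
  obtain ⟨q, hq⟩ := Polynomial.exists_coe_eq_X_pow_mul hdvd
  have hdvd' := X_pow_dvd_eulerDerivative hdvd
  rw [eulerDerivative_coe] at hdvd'
  obtain ⟨q', hq'⟩ := Polynomial.exists_coe_eq_X_pow_mul hdvd'
  rw [← eulerDerivative_coe] at hq'
  push_cast at hq hq'
  have hD : eulerDerivative ((P : ℝ⟦X⟧) * (L : ℝ⟦X⟧) - 1) =
      (P : ℝ⟦X⟧) * eulerDerivative (L : ℝ⟦X⟧) + L * eulerDerivative (P : ℝ⟦X⟧) := by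
    rw [eulerDerivative_sub, eulerDerivative_mul]
    simp [eulerDerivative]
  rw [hD] at hq'
  obtain ⟨h₁, hh₁, e₁⟩ := HasGraphGrowth.exists_mul_eq_X_pow_mul ha hH hP hL
  obtain ⟨h₂, hh₂, e₂⟩ := HasGraphGrowth.exists_mul_eq_X_pow_mul (eulerDerivative_mem ha) hH
    (X_pow_dvd_eulerDerivative hP) hL
  rw [eulerDerivative_sub] at e₂
  have hqm := coe_mem_graphGrowthSubalgebra q
  have hqm' := coe_mem_graphGrowthSubalgebra q'
  have hDP := eulerDerivative_mem hPm
  have hDL := eulerDerivative_mem hLm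
  -- Put a = T - P and H = U - L. Beyond `Da · H` and `-P · DL`, the terms `DP · H - a · DL` remain.
  -- Multiply them by 1 = P L - X ^ m q, and replace `a L` using a L + P H = -X ^ m (q + h₁), which
  -- is T U = 1. The part not yet divisible becomes H P (P DL + L DP) = H P X ^ m q'.
  refine ⟨h₂ + ((q : ℝ⟦X⟧) + h₁) * (P : ℝ⟦X⟧) * eulerDerivative (L : ℝ⟦X⟧) +
    (T - (P : ℝ⟦X⟧)) * (q : ℝ⟦X⟧) * eulerDerivative (L : ℝ⟦X⟧) +
    (U - (L : ℝ⟦X⟧)) * (P : ℝ⟦X⟧) * (q' : ℝ⟦X⟧) -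
    (U - (L : ℝ⟦X⟧)) * (q : ℝ⟦X⟧) * eulerDerivative (P : ℝ⟦X⟧), ?_, ?_⟩
  · exact sub_mem (add_mem (add_mem (add_mem hh₂ (mul_mem (mul_mem (add_mem hqm hh₁) hPm) hDL))
      (mul_mem (mul_mem ha hqm) hDL)) (mul_mem (mul_mem hH hPm) hqm')) (mul_mem (mul_mem hH hqm) hDP)
  · rw [eulerDerivative_mul]
    generalize eulerDerivative (P : ℝ⟦X⟧) = DP at *
    generalize eulerDerivative (L : ℝ⟦X⟧) = DL at *
    generalize eulerDerivative T = DT at *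
    generalize (P : ℝ⟦X⟧) = P at *
    generalize (L : ℝ⟦X⟧) = L at *
    linear_combination e₂ + e₁ * P * DL + hq * (P * DL + (T - P) * DL - (U - L) * DP) +
      hq' * ((U - L) * P) - hTU * P * DL

end PowerSeries

/-! ### Generating function identities and the count of connected graphs. -/

section Expansion

open PowerSeries
open scoped Nat

/-- The exponential generating function of a sequence. -/
noncomputable def expGenFun (a : ℕ → ℝ) : ℝ⟦X⟧ := mk fun n => a n / n !

theorem coeff_expGenFun_mul_factorial (a : ℕ → ℝ) (n : ℕ) :
    coeff n (expGenFun a) * n ! = a n := by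
  rw [expGenFun, coeff_mk, div_mul_cancel₀ _ (by positivity)]

theorem expGenFun_mul (a b : ℕ → ℝ) :
    expGenFun a * expGenFun b =
      expGenFun fun n => ∑ k ∈ Finset.range (n + 1), n.choose k * (a k * b (n - k)) := by
  ext n
  simp only [expGenFun, coeff_mul, coeff_mk]
  rw [Finset.Nat.sum_antidiagonal_eq_sum_range_succ_mk, Finset.sum_div]
  refine Finset.sum_congr rfl fun k hk => ?_
  rw [Nat.cast_choose ℝ (Nat.lt_succ_iff.1 (Finset.mem_range.1 hk))]
  have : (n ! : ℝ) ≠ 0 := by positivity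
  field_simp

theorem eulerDerivative_expGenFun (a : ℕ → ℝ) :
    eulerDerivative (expGenFun a) = expGenFun fun n => n * a n := by
  ext n
  rw [coeff_eulerDerivative, expGenFun, expGenFun, coeff_mk, coeff_mk, mul_div_assoc]

theorem expGenFun_mem {a : ℕ → ℝ} (h : ∀ n, |a n| ≤ 2 ^ n.choose 2) :
    expGenFun a ∈ graphGrowthSubalgebra := by
  refine HasGraphGrowth.of_le 1 fun n => ?_
  rw [expGenFun, coeff_mk, abs_div, Nat.abs_cast, div_mul_cancel₀ _ (by positivity), one_mul]
  exact h n

/-- The exponential coefficients of the inverse of the generating function of graphs. -/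
noncomputable def invGraphCoeff (k : ℕ) : ℝ :=
  if k = 0 then 1 else -(numIrreducibleTournaments k : ℝ)

theorem abs_invGraphCoeff_le (k : ℕ) : |invGraphCoeff k| ≤ 2 ^ k.choose 2 := by
  rw [invGraphCoeff]
  split_ifs with h
  · simp [h]
  · rw [abs_neg, Nat.abs_cast]
    exact_mod_cast numIrreducibleTournaments_le k

theorem graphs_mul_invGraphCoeff :
    (expGenFun fun n => 2 ^ n.choose 2) * expGenFun invGraphCoeff = 1 := by
  rw [mul_comm, expGenFun_mul]
  ext n
  rw [expGenFun, coeff_mk, coeff_one]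
  split_ifs with hn
  · simp [hn, invGraphCoeff]
  · rw [div_eq_zero_iff]
    left
    have h : (2 : ℝ) ^ n.choose 2 = ∑ k ∈ Finset.range (n + 1), (n.choose k : ℝ) *
        if k = 0 then 0 else (numIrreducibleTournaments k : ℝ) * 2 ^ (n - k).choose 2 := by
      exact_mod_cast card_tournament_eq_sum hn
    rw [Finset.sum_range_succ'] at h ⊢
    simp only [invGraphCoeff, Nat.succ_ne_zero, if_false, if_true, mul_zero, add_zero,
      Nat.choose_zero_right, Nat.cast_one, one_mul, Nat.sub_zero] at h ⊢
    simp only [neg_mul, mul_neg, Finset.sum_neg_distrib]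
    rw [← h, neg_add_cancel]

theorem eulerDerivative_graphs :
    eulerDerivative (expGenFun fun n => 2 ^ n.choose 2) =
      eulerDerivative (expGenFun fun n => numConnectedGraphs n) *
        expGenFun fun n => 2 ^ n.choose 2 := by
  rw [eulerDerivative_expGenFun, eulerDerivative_expGenFun, expGenFun_mul]
  congr 1
  ext n
  exact_mod_cast mul_card_simpleGraph_eq_sum n

theorem coeff_mul_trunc_mul_factorial (a b : ℕ → ℝ) {m n : ℕ} (hn : m ≤ n) :
    coeff n (expGenFun a * (trunc m (expGenFun b) : ℝ⟦X⟧)) * n ! =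
      ∑ k ∈ Finset.range m, n.choose k * (b k * a (n - k)) := by
  have h : (trunc m (expGenFun b) : ℝ⟦X⟧) = expGenFun fun k => if k < m then b k else 0 := by
    ext k
    rw [Polynomial.coeff_coe, coeff_trunc, expGenFun, expGenFun, coeff_mk, coeff_mk, ite_div,
      zero_div]
  rw [h, mul_comm (expGenFun a), expGenFun_mul, coeff_expGenFun_mul_factorial]
  refine (Finset.sum_subset (Finset.range_subset_range.2 (hn.trans n.le_succ)) ?_).symm.trans ?_
  · intro k _ hk
    simp [Finset.mem_range.not.1 hk]
  · refine Finset.sum_congr rfl fun k hk => ?_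
    rw [if_pos (Finset.mem_range.1 hk)]

theorem X_pow_dvd_sub_trunc (f : ℝ⟦X⟧) (m : ℕ) : X ^ m ∣ f - (trunc m f : ℝ⟦X⟧) := by
  rw [X_pow_dvd_iff]
  intro d hd
  rw [map_sub, coeff_coe_trunc_of_lt hd, sub_self]

theorem abs_numConnectedGraphs_sub_le (m : ℕ) :
    ∃ (M : ℕ) (K : ℝ), 0 ≤ K ∧ ∀ᶠ n : ℕ in atTop,
      |numConnectedGraphs n - ∑ k ∈ Finset.range m,
          n.choose k * (invGraphCoeff k * 2 ^ (n - k).choose 2)| ≤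
        K * (n + 1 : ℝ) ^ M * 2 ^ (n - m).choose 2 := by
  set T := expGenFun fun n => 2 ^ n.choose 2 with hT
  set U := expGenFun invGraphCoeff with hU
  set C := expGenFun fun n => (numConnectedGraphs n : ℝ) with hC
  set L := trunc m U with hL
  have hTm : T ∈ graphGrowthSubalgebra := expGenFun_mem fun n => by
    rw [abs_of_nonneg (by positivity)]
  have hTU : T * U = 1 := graphs_mul_invGraphCoeff
  have hDC : eulerDerivative C = eulerDerivative T * U := by
    have h : eulerDerivative T = eulerDerivative C * T := eulerDerivative_graphs
    linear_combination (-eulerDerivative C) * hTU - U * h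
  obtain ⟨h, ⟨M, K, hK, hh⟩, he⟩ := exists_eulerDerivative_mul_sub_eq hTm
    (expGenFun_mem abs_invGraphCoeff_le) hTU (X_pow_dvd_sub_trunc T m) (X_pow_dvd_sub_trunc U m)
  rw [← hDC, ← eulerDerivative_sub, eulerDerivative_coe, ← Polynomial.coe_mul] at he
  set Q := trunc m T * (Polynomial.X * Polynomial.derivative (trunc m U))
  refine ⟨M + m, K, hK, ?_⟩
  -- Beyond the degree of `Q` the polynomial part of the error contributes nothing.
  filter_upwards [eventually_gt_atTop Q.natDegree, eventually_ge_atTop m,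
    eventually_ge_atTop 1] with n hnQ hnm hn1
  have hcoeff : n * coeff n (C - T * (L : ℝ⟦X⟧)) = coeff (n - m) h := by
    have := congrArg (coeff n) he
    rw [coeff_eulerDerivative, map_sub _ (X ^ m * h), Polynomial.coeff_coe,
      Polynomial.coeff_eq_zero_of_natDegree_lt hnQ, sub_zero, coeff_X_pow_mul', if_pos hnm] at this
    exact this
  have hval : (numConnectedGraphs n : ℝ) - ∑ k ∈ Finset.range m,
      n.choose k * (invGraphCoeff k * 2 ^ (n - k).choose 2) =
      coeff n (C - T * (L : ℝ⟦X⟧)) * n ! := by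
    rw [map_sub, sub_mul, hC, coeff_expGenFun_mul_factorial, hT, hL, hU,
      coeff_mul_trunc_mul_factorial _ _ hnm]
  have hle : |coeff n (C - T * (L : ℝ⟦X⟧))| ≤ |coeff (n - m) h| := by
    rw [← hcoeff, abs_mul, Nat.abs_cast]
    exact le_mul_of_one_le_left (abs_nonneg _) (by exact_mod_cast hn1)
  -- The growth of `h` is normalised by `(n - m)!`; passing to `n !` costs only a polynomial factor.
  have hfac : (n ! : ℝ) ≤ (n - m)! * (n + 1 : ℝ) ^ m := by
    rw [← Nat.factorial_mul_descFactorial hnm]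
    exact_mod_cast Nat.mul_le_mul_left _
      ((Nat.descFactorial_le_pow n m).trans (Nat.pow_le_pow_left n.le_succ m))
  rw [hval, abs_mul, Nat.abs_cast]
  calc _ ≤ |coeff (n - m) h| * ((n - m)! * (n + 1 : ℝ) ^ m) := by gcongr
    _ = |coeff (n - m) h| * (n - m)! * (n + 1 : ℝ) ^ m := by ring
    _ ≤ K * ((n - m : ℕ) + 1 : ℝ) ^ M * 2 ^ (n - m).choose 2 * (n + 1 : ℝ) ^ m := by
      exact mul_le_mul_of_nonneg_right (hh (n - m)) (by positivity)
    _ ≤ K * (n + 1 : ℝ) ^ M * 2 ^ (n - m).choose 2 * (n + 1 : ℝ) ^ m := by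
      gcongr
      omega
    _ = _ := by ring

/-! ### From counts to probabilities and asymptotic scales. -/

theorem choose_two_add_triangle {k n : ℕ} (hk : k ≤ n) :
    (n - k).choose 2 + k * n = n.choose 2 + k * (k + 1) / 2 := by
  obtain ⟨j, rfl⟩ := Nat.exists_eq_add_of_le hk
  have h1 : k * (k + 1) / 2 = (k + 1).choose 2 := by
    rw [Nat.choose_two_right, Nat.add_sub_cancel, mul_comm]
  have h2 : ∀ i : ℕ, i.choose 2 + (i + 1).choose 2 = i * i := by
    intro i
    induction i with
    | zero => rfl
    | succ i ih =>
      have h3 := add_choose_two i 1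
      have h4 := add_choose_two (i + 1) 1
      rw [Nat.choose_eq_zero_of_lt one_lt_two] at h3 h4
      linarith
  rw [Nat.add_sub_cancel_left, h1, add_choose_two k j, mul_add, ← h2]
  ring

theorem two_pow_div_two_pow {k n : ℕ} (hk : k ≤ n) :
    (2 : ℝ) ^ (k * (k + 1) / 2) / 2 ^ (k * n) = 2 ^ (n - k).choose 2 / 2 ^ n.choose 2 := by
  rw [div_eq_div_iff (by positivity) (by positivity), ← pow_add, ← pow_add,
    choose_two_add_triangle hk, add_comm]

theorem connectedTerm_eq {k n : ℕ} (hk : k ≤ n) :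
    connectedTerm k n =
      n.choose k * (invGraphCoeff k * 2 ^ (n - k).choose 2) / 2 ^ n.choose 2 := by
  rw [connectedTerm, invGraphCoeff]
  split_ifs with h
  · subst h
    simp
  · rw [two_pow_div_two_pow hk]
    ring

theorem probConnected_eq (n : ℕ) :
    probConnected n = numConnectedGraphs n / 2 ^ n.choose 2 := by
  have := natCard_simpleGraph (V := Fin n)
  rw [Fintype.card_fin] at this
  rw [probConnected, this, numConnectedGraphs]
  push_cast
  rfl

theorem abs_probConnected_sub_le (m : ℕ) :
    ∃ (M : ℕ) (K : ℝ), 0 ≤ K ∧ ∀ᶠ n : ℕ in atTop,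
      |probConnected n - ∑ k ∈ Finset.range m, connectedTerm k n| ≤
        K * ((n + 1 : ℝ) ^ M / 2 ^ (m * n)) := by
  obtain ⟨M, K, hK, h⟩ := abs_numConnectedGraphs_sub_le m
  refine ⟨M, K * 2 ^ (m * (m + 1) / 2), by positivity, ?_⟩
  filter_upwards [h, eventually_ge_atTop m] with n hn hnm
  have hsum : ∑ k ∈ Finset.range m, connectedTerm k n = (∑ k ∈ Finset.range m,
      n.choose k * (invGraphCoeff k * 2 ^ (n - k).choose 2)) / 2 ^ n.choose 2 := by
    rw [Finset.sum_div]
    exact Finset.sum_congr rfl fun k hk =>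
      connectedTerm_eq ((Finset.mem_range.1 hk).le.trans hnm)
  rw [hsum, probConnected_eq, ← sub_div, abs_div, abs_of_pos (a := (2 : ℝ) ^ _) (by positivity)]
  calc _ ≤ K * (n + 1 : ℝ) ^ M * 2 ^ (n - m).choose 2 / 2 ^ n.choose 2 := by gcongr
    _ = K * (n + 1 : ℝ) ^ M * (2 ^ (m * (m + 1) / 2) / 2 ^ (m * n)) := by
      rw [two_pow_div_two_pow hnm]; ring
    _ = _ := by ring

/-- The order of magnitude of the term of index `k`. -/
noncomputable def connectedScale (k n : ℕ) : ℝ := (n : ℝ) ^ k / (2 : ℝ) ^ (k * n)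

theorem isBigO_connectedTerm (k : ℕ) : connectedTerm k =O[atTop] connectedScale k := by
  refine IsBigO.of_bound (max 1 (numIrreducibleTournaments k * 2 ^ (k * (k + 1) / 2)))
    (Eventually.of_forall fun n => ?_)
  rw [connectedTerm, connectedScale]
  split_ifs with h
  · subst h
    simp
  · have hc : (n.choose k : ℝ) ≤ (n : ℝ) ^ k := by exact_mod_cast Nat.choose_le_pow n k
    rw [Real.norm_eq_abs, Real.norm_eq_abs, abs_neg, abs_of_nonneg (by positivity),
      abs_of_nonneg (by positivity)]
    calc _ ≤ (numIrreducibleTournaments k : ℝ) * (n : ℝ) ^ k *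
          (2 ^ (k * (k + 1) / 2) / 2 ^ (k * n)) := by gcongr
      _ = numIrreducibleTournaments k * 2 ^ (k * (k + 1) / 2) * (n ^ k / 2 ^ (k * n)) := by ring
      _ ≤ _ := by gcongr; exact le_max_right _ _

/-- A term that is not identically zero has a nonzero constant coefficient, so it attains its full
order because `n.choose k` is of order `n ^ k`. -/
theorem isBigO_connectedScale {k : ℕ} (hk : connectedTerm k ≠ 0) :
    connectedScale k =O[atTop] connectedTerm k := by
  by_cases h : k = 0
  · subst h
    refine IsBigO.of_bound 1 (Eventually.of_forall fun n => ?_)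
    simp [connectedTerm, connectedScale]
  · have hit : (numIrreducibleTournaments k : ℝ) ≠ 0 := by
      intro h0
      apply hk
      ext n
      simp [connectedTerm, h, h0]
    have h1 := (((isTheta_choose k).isBigO_symm).mul
      (isBigO_refl (fun n : ℕ => ((2 : ℝ) ^ (k * n))⁻¹) atTop)).trans
      (isBigO_const_mul_self (-((numIrreducibleTournaments k : ℝ) * 2 ^ (k * (k + 1) / 2))⁻¹)
        (connectedTerm k) atTop |>.congr_left fun n => ?_)
    · exact h1.congr_left fun n => by rw [connectedScale, div_eq_mul_inv]
    · rw [connectedTerm, if_neg h]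
      field_simp

theorem isLittleO_pow_div_two_pow (M : ℕ) {d : ℕ} (hd : d ≠ 0) :
    (fun n : ℕ => (n : ℝ) ^ M / 2 ^ (d * n)) =o[atTop] fun _ => (1 : ℝ) := by
  have h := isLittleO_pow_const_const_pow_of_one_lt (R := ℝ) M
    (one_lt_pow₀ (one_lt_two (α := ℝ)) hd)
  rw [isLittleO_one_iff]
  simpa only [pow_mul] using h.tendsto_div_nhds_zero

theorem isLittleO_connectedScale {k l : ℕ} (h : k < l) :
    connectedScale l =o[atTop] connectedScale k := by
  obtain ⟨d, rfl⟩ := Nat.exists_eq_add_of_lt h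
  have := (isBigO_refl (connectedScale k) atTop).mul_isLittleO
    (isLittleO_pow_div_two_pow (d + 1) (Nat.succ_ne_zero d))
  refine (this.congr_left fun n => ?_).congr_right fun n => mul_one _
  rw [connectedScale, connectedScale, div_mul_div_comm, ← pow_add, ← pow_add, ← add_mul]
  rfl

theorem isBigO_probConnected_sub (r : ℕ) :
    (fun n => probConnected n - ∑ k ∈ Finset.range (r + 1), connectedTerm k n)
      =O[atTop] connectedScale (r + 1) := by
  -- One extra term is taken: its error gains a factor `2 ^ (-n)`, which beats the uncontrolled
  -- power `n ^ M`. The extra term itself has the required order.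
  obtain ⟨M, K, hK, h⟩ := abs_probConnected_sub_le (r + 2)
  have h1 : (fun n => probConnected n - ∑ k ∈ Finset.range (r + 2), connectedTerm k n)
      =O[atTop] fun n : ℕ => (n : ℝ) ^ (M + (r + 1)) / 2 ^ ((r + 2) * n) := by
    refine IsBigO.of_bound (K * 2 ^ M) ?_
    filter_upwards [h, eventually_ge_atTop 1] with n hn hn1
    have hn1' : (1 : ℝ) ≤ n := by exact_mod_cast hn1
    rw [Real.norm_eq_abs, Real.norm_of_nonneg (by positivity)]
    refine hn.trans ?_
    rw [mul_assoc, ← mul_div_assoc (2 ^ M)]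
    refine mul_le_mul_of_nonneg_left (div_le_div_of_nonneg_right ?_ (by positivity)) hK
    calc (n + 1 : ℝ) ^ M ≤ (2 * n) ^ M := by gcongr; linarith
      _ = 2 ^ M * n ^ M := mul_pow _ _ _
      _ ≤ 2 ^ M * n ^ (M + (r + 1)) := by gcongr; omega
  have h2 : (fun n : ℕ => (n : ℝ) ^ (M + (r + 1)) / 2 ^ ((r + 2) * n))
      =O[atTop] connectedScale (r + 1) := by
    have := (isBigO_refl (connectedScale (r + 1)) atTop).mul
      (isLittleO_pow_div_two_pow M one_ne_zero).isBigO
    refine (this.congr_left fun n => ?_).congr_right fun n => mul_one _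
    rw [connectedScale, div_mul_div_comm, ← pow_add, ← pow_add, add_comm M,
      show (r + 2) * n = (r + 1) * n + 1 * n by ring]
  refine ((h1.trans h2).add (isBigO_connectedTerm (r + 1))).congr_left fun n => ?_
  rw [Finset.sum_range_succ _ (r + 1)]
  ring

/-- The indices skipped by `e` carry zero terms, so a partial sum up to `e r` equals the full one
over all indices below `e (r + 1)`, and its error is of the scale of that next nonzero term. -/
theorem isAsymptoticExpansion_connectedTerm {e : ℕ → ℕ} (he : StrictMono e)
    (hrange : Set.range e = {k | connectedTerm k ≠ 0}) :
    IsAsymptoticExpansion probConnected 0 (fun j => connectedTerm (e j)) := by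
  have hne : ∀ j, connectedTerm (e j) ≠ 0 := fun j => by
    have : e j ∈ {k | connectedTerm k ≠ 0} := hrange ▸ Set.mem_range_self j
    exact this
  refine ⟨fun r _ => ?_, fun k _ => ?_⟩
  · obtain ⟨s, hs⟩ := Nat.exists_eq_succ_of_ne_zero
      (Nat.ne_of_gt ((Nat.zero_le (e r)).trans_lt (he r.lt_succ_self)))
    have hsum : ∀ n, ∑ j ∈ Finset.Icc 0 r, connectedTerm (e j) n =
        ∑ k ∈ Finset.range (s + 1), connectedTerm k n := by
      intro n
      rw [← Finset.sum_image (f := fun k => connectedTerm k n) (he.injective.injOn)]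
      refine Finset.sum_subset ?_ ?_
      · intro k hk
        obtain ⟨j, hj, rfl⟩ := Finset.mem_image.1 hk
        rw [Finset.mem_range, ← Nat.succ_eq_add_one, ← hs]
        exact he (Nat.lt_succ_of_le (Finset.mem_Icc.1 hj).2)
      · intro k hk hk'
        by_contra hn
        obtain ⟨j, rfl⟩ : k ∈ Set.range e := by
          rw [hrange]
          exact fun h0 => hn (congrFun h0 n)
        rw [Finset.mem_range, ← Nat.succ_eq_add_one, ← hs, he.lt_iff_lt] at hk
        exact hk' (Finset.mem_image_of_mem e (Finset.mem_Icc.2 ⟨Nat.zero_le _, by omega⟩))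
    have h1 := (isBigO_probConnected_sub s).congr_left fun n => by rw [← hsum n]
    refine h1.trans ?_
    have h2 := isBigO_connectedScale (hne (r + 1))
    have hs' : e (r + 1) = s + 1 := hs
    rw [hs'] at h2
    simpa only [hs'] using h2
  · exact ((isBigO_connectedTerm _).trans_isLittleO
      (isLittleO_connectedScale (he k.lt_succ_self))).trans_isBigO (isBigO_connectedScale (hne k))

theorem connectedTerm_ne_zero {k : ℕ} (hk : 3 ≤ k) : connectedTerm k ≠ 0 := by
  intro h
  have h1 := congrFun h k
  have h2 : (0 : ℝ) < numIrreducibleTournaments k := by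
    exact_mod_cast numIrreducibleTournaments_pos hk
  rw [connectedTerm, if_neg (by omega), Nat.choose_self, Pi.zero_apply, neg_eq_zero] at h1
  have : (0 : ℝ) < numIrreducibleTournaments k * ((1 : ℕ) : ℝ) *
      (2 ^ (k * (k + 1) / 2) / 2 ^ (k * k)) := by positivity
  exact this.ne' h1

end Expansion

theorem mainTheorem4 :
    -- the expansion, with the identically vanishing terms left out
    (∃ e : ℕ → ℕ, StrictMono e ∧ Set.range e = {k | connectedTerm k ≠ 0} ∧
      IsAsymptoticExpansion probConnected 0 (fun j => connectedTerm (e j))) ∧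
    -- the same with all terms kept, for every order of truncation
    (∀ r : ℕ, (fun n : ℕ => probConnected n -
        (1 - ∑ k ∈ Finset.Icc 1 r, (numIrreducibleTournaments k : ℝ) * (n.choose k : ℝ) *
          ((2 : ℝ) ^ (k * (k + 1) / 2) / (2 : ℝ) ^ (k * n))))
      =O[atTop] fun n : ℕ => (n : ℝ) ^ (r + 1) / (2 : ℝ) ^ ((r + 1) * n)) ∧
    -- the first coefficients, which give Wright's expansion for `r = 4`
    numIrreducibleTournaments 1 = 1 ∧ numIrreducibleTournaments 2 = 0 ∧
    numIrreducibleTournaments 3 = 2 ∧ numIrreducibleTournaments 4 = 24 := by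
  refine ⟨?_, fun r => ?_, numIrreducibleTournaments_one, numIrreducibleTournaments_two,
    numIrreducibleTournaments_three, numIrreducibleTournaments_four⟩
  · have hinf : {k | connectedTerm k ≠ 0}.Infinite :=
      (Set.Ici_infinite 3).mono fun k hk => connectedTerm_ne_zero hk
    have hmono := Nat.nth_strictMono hinf
    have hrange := Nat.range_nth_of_infinite hinf
    exact ⟨_, hmono, hrange, isAsymptoticExpansion_connectedTerm hmono hrange⟩
  · refine (isBigO_probConnected_sub r).congr_left fun n => ?_
    have hIco : Finset.Ico 1 (r + 1) = Finset.Icc 1 r := by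
      ext k
      simp
    rw [Finset.range_eq_Ico, Finset.sum_eq_sum_Ico_succ_bot (Nat.succ_pos r), zero_add, hIco,
      sub_eq_add_neg 1, ← Finset.sum_neg_distrib]
    congr 2
    refine Finset.sum_congr rfl fun k hk => ?_
    rw [connectedTerm, if_neg (by have := (Finset.mem_Icc.1 hk).1; omega)]
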